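/- **Theorem (one-way communication complexity of $k$-$\mathbf{UR}_r^{\le m}$).** In the support-bounded universal relation problem $k$-$\mathbf{UR}_r^{\le m}$, Alice holds $x_A\in\{0,1\}^{2^r}$ and Bob holds $x_B\in\{0,1\}^{2^r}$, with the promise that $\mathrm{Supp}(x_B)\subseteq \mathrm{Supp}(x_A)$ and $k\le|\mathrm{Supp}(x_A)\setminus\mathrm{Supp}(x_B)|\le m$. Using public randomness, Alice sends Bob a single message, after which Bob must output $k$ distinct indices $i$ with $(x_A)_i\ne(x_B)_i$; on every input satisfying the promise he may fail with probability at most $\delta$. Let $R^{\to}_{\delta}(k\text{-}\mathbf{UR}_r^{\le m})$ be the least number $b$ of bits such that some such protocol with $b$-bit messages exists. For every $\varepsilon>0$ there is a constant $c=c(\varepsilon)>0$ such that for all integers $r\ge2$, $k\ge1$ and $m$ with $$\max(2k,\log^5 r)\le m\le 2^r,\qquad k\le 2^{(1-\varepsilon)r},$$ and all $0\le\delta\le 1/r^5$ (in particular for $\delta=1/r^5$ and for $\delta=1/(2r^6)$), $$R^{\to}_{\delta}(k\text{-}\mathbf{UR}_r^{\le m})\ \ge\ c\,k\,r\,\log(m/k).$$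 -/

import Mathlib

open MeasureTheory

namespace UniversalRelation

/-- Input strings: vectors in `{0,1}^(2^r)`. -/
abbrev Input (r : ℕ) : Type := Fin (2 ^ r) → Bool

/-- The support of a `0/1` vector. -/
def supp {r : ℕ} (x : Input r) : Finset (Fin (2 ^ r)) :=
  Finset.univ.filter fun i => x i = true

/-- The promise of the support-bounded universal relation problem: `supp y ⊆ supp x` and the
difference of the supports has at least `k` and at most `m` elements. -/
def Promise (r k m : ℕ) (x y : Input r) : Prop :=
  supp y ⊆ supp x ∧ k ≤ (supp x \ supp y).card ∧ (supp x \ supp y).card ≤ m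

/-- A correct answer on `(x, y)`: a set of `k` indices, at each of which `x` and `y` differ. -/
def Correct {r : ℕ} (k : ℕ) (x y : Input r) (S : Finset (Fin (2 ^ r))) : Prop :=
  S.card = k ∧ ∀ i ∈ S, x i ≠ y i

/-- A one-way public-coin protocol on inputs in `{0,1}^(2^r)` with a message of `b` bits. Both
players see the public random outcome `ω`, drawn from an arbitrary probability space. Alice's
message depends on `ω` and her input only; Bob's output (a set of indices) depends on `ω`, on the
message and on his input only. -/
structure Protocol (r b : ℕ) where
  Ω : Type
  mΩ : MeasurableSpace Ω
  μ : Measure Ω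
  isProb : IsProbabilityMeasure μ
  alice : Ω → Input r → (Fin b → Bool)
  bob : Ω → (Fin b → Bool) → Input r → Finset (Fin (2 ^ r))
  measurable_alice : ∀ x msg, MeasurableSet {ω | alice ω x = msg}
  measurable_bob : ∀ msg y S, MeasurableSet {ω | bob ω msg y = S}

attribute [instance] Protocol.mΩ Protocol.isProb

/-- Bob's output on the input pair `(x, y)` and the public random outcome `ω`. -/
def Protocol.output {r b : ℕ} (P : Protocol r b) (ω : P.Ω) (x y : Input r) :
    Finset (Fin (2 ^ r)) :=
  P.bob ω (P.alice ω x) y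

/-- The protocol solves `k`-`UR_r^{≤ m}` with failure probability at most `δ`: on every input pair
that satisfies the promise, the output is incorrect with probability at most `δ`. -/
def Protocol.Solves {r b : ℕ} (P : Protocol r b) (k m : ℕ) (δ : ℝ) : Prop :=
  ∀ x y : Input r, Promise r k m x y → P.μ.real {ω | ¬ Correct k x y (P.output ω x y)} ≤ δ

/-- The one-way public-coin communication complexity of `k`-`UR_r^{≤ m}` with failure
probability `δ`: the least number of bits in the message of a protocol that solves it. -/
noncomputable def complexity (r k m : ℕ) (δ : ℝ) : ℕ :=
  sInf {b : ℕ | ∃ P : Protocol r b, P.Solves k m δ}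

/-- Sending the whole input solves the problem, so the infimum is over a nonempty set. -/
theorem exists_protocol (r k m : ℕ) {δ : ℝ} (hδ : 0 ≤ δ) :
    {b : ℕ | ∃ P : Protocol r b, P.Solves k m δ}.Nonempty := by
  classical
  refine ⟨2 ^ r, ⟨Unit, ⊤, Measure.dirac (), inferInstance, fun _ x => x, fun _ x y =>
    if h : ∃ S, S ⊆ supp x \ supp y ∧ S.card = k then h.choose else ∅,
    fun _ _ => trivial, fun _ _ _ => trivial⟩, ?_⟩
  intro x y hxy
  have h : ∃ S, S ⊆ supp x \ supp y ∧ S.card = k := Finset.exists_subset_card_eq hxy.2.1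
  convert hδ
  convert measureReal_empty
  refine Set.eq_empty_iff_forall_notMem.2 fun ω hω => hω ?_
  simp only [Protocol.output, dif_pos h]
  refine ⟨h.choose_spec.2, fun i hi => ?_⟩
  have := h.choose_spec.1 hi
  simp [supp] at this
  simp [this.1, this.2]

end UniversalRelation

open Finset

/-! ### Counting and averaging tools -/

namespace UniversalRelation

/-! The bound is an encoding argument. Split part of the universe into `k * 2 ^ R` blocks of size
`L`, indexed by `(u, e)` with `e` a string of `R` bits; Alice holds one element of each block,
chosen by `f`. For a string `ρ` and a position `j`, Bob is shown the elements of the blocks whose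
`e` differs from `ρ` somewhere below `j`, so a correct answer names `k` elements of the blocks still
agreeing with `ρ` below `j`. Bob's input ignores bit `j` of `ρ`, so for random `ρ` on average half
of these lie in blocks with `e j ≠ ρ j`, all of which are shown from the next step on
(`two_mul_sum_card_foundAt`).

Running Bob at `j = 0, 1, …` on the one message therefore recovers about `k R / 2` values of `f` for
free, each worth `log L`. The message and `R` bits telling which answers are correct must pay for
this (`sum_pow_card_predicted_le`, `sum_card_foundAt_mul_log_le`), so `b + R` is at least about `(k
/ 2) R log₂ L`. Taking `2 ^ R ≈ √(m / k)` leaves `log L` of order `ε r`. Bounded `r` only needs `b ≥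
1`. -/

/-- **Prediction lemma.** Suppose that `Q f e` is a guess of the value `f e` that depends only on
the values of `f` at lower levels and is never wrong for `f ∈ G`. Then the functions in `G` are few,
when each of them is weighted by the number of its values that are guessed. -/
theorem sum_pow_card_predicted_le {ι Λ : Type*} [Fintype ι] [DecidableEq ι] [Fintype Λ]
    [DecidableEq Λ] (level : ι → ℕ) (Q : (ι → Λ) → ι → Λ → Prop)
    [∀ f, DecidablePred fun e => Q f e (f e)]
    (hQ : ∀ f g e, (∀ e', level e' < level e → f e' = g e') → Q f e = Q g e)
    (G : Finset (ι → Λ)) (hG : ∀ f ∈ G, ∀ e p, Q f e p → p = f e) :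
    ∑ f ∈ G, Fintype.card Λ ^ #{e | Q f e (f e)} ≤ Fintype.card Λ ^ Fintype.card ι := by
  -- Guessed values need not be stored, so their places can carry arbitrary data. The sum to be
  -- bounded counts the pairs (function, data).
  let Φ : (Σ f : G, ({e // Q f.1 e (f.1 e)} → Λ)) → ι → Λ := fun s e =>
    if h : Q s.1.1 e (s.1.1 e) then s.2 ⟨e, h⟩ else s.1.1 e
  have hΦ : Function.Injective Φ := by
    rintro ⟨⟨f, hf⟩, u⟩ ⟨⟨g, hg⟩, v⟩ h
    -- Decoding level by level: lower levels decide whether a value is guessed; it is then the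
    -- guess, and otherwise it is stored in clear.
    have key : ∀ n, ∀ e, level e = n → f e = g e := by
      intro n
      induction n using Nat.strong_induction_on with
      | _ n ih =>
        intro e he
        have hq : Q f e = Q g e := hQ f g e fun e' he' => ih _ (he ▸ he') e' rfl
        by_cases h1 : Q f e (f e)
        · exact hG g hg e _ (hq ▸ h1)
        · have h2 : ¬ Q g e (g e) := fun h2 =>
            h1 (by rw [← hG f hf e _ (hq.symm ▸ h2 : Q f e (g e))]; exact hq.symm ▸ h2)
          have := congrFun h e
          simpa only [Φ, dif_neg h1, dif_neg h2] using this
    obtain rfl : f = g := funext fun e => key _ e rfl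
    congr 1
    funext ⟨e, he⟩
    have := congrFun h e
    simpa only [Φ, dif_pos he] using this
  have := Fintype.card_le_of_injective Φ hΦ
  rw [Fintype.card_sigma, Fintype.card_fun] at this
  simp only [Fintype.card_fun, Fintype.card_subtype] at this
  rwa [← Finset.sum_coe_sort G (fun f => Fintype.card Λ ^ #{e | Q f e (f e)})]

/-- If the exponentials of the `X i` are at most `exp a` on average, then the `X i` are at most `a`
on average. -/
theorem sum_le_card_mul_of_sum_exp_le {ι : Type*} (s : Finset ι) (X : ι → ℝ) (a : ℝ)
    (h : ∑ i ∈ s, Real.exp (X i) ≤ Real.exp a * #s) : ∑ i ∈ s, X i ≤ #s * a := by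
  have h1 : ∑ i ∈ s, (X i - a + 1) ≤ #s := by
    calc ∑ i ∈ s, (X i - a + 1) ≤ ∑ i ∈ s, Real.exp (X i) * Real.exp (-a) :=
          Finset.sum_le_sum fun i _ => by
            rw [← Real.exp_add, ← sub_eq_add_neg]; exact Real.add_one_le_exp _
      _ = (∑ i ∈ s, Real.exp (X i)) * Real.exp (-a) := by rw [Finset.sum_mul]
      _ ≤ Real.exp a * #s * Real.exp (-a) := by gcongr
      _ = #s * (Real.exp a * Real.exp (-a)) := by ring
      _ = #s := by rw [← Real.exp_add]; simp
  simp only [Finset.sum_add_distrib, Finset.sum_sub_distrib, Finset.sum_const, nsmul_eq_mul,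
    mul_one] at h1
  linarith

/-- Some public random outcome is at least as good as the average one on a family of inputs. -/
theorem Protocol.Solves.exists_outcome {r b k m : ℕ} {δ : ℝ} {P : Protocol r b}
    (hP : P.Solves k m δ) {τ : Type*} [Fintype τ] (x y : τ → Input r)
    (h : ∀ t, Promise r k m (x t) (y t)) :
    ∃ ω, (Fintype.card τ : ℝ) * (1 - δ) ≤
      ∑ t, Set.indicator {ω | Correct k (x t) (y t) (P.output ω (x t) (y t))} (fun _ => (1 : ℝ)) ω
      := by
  have hms : ∀ t, MeasurableSet {ω | Correct k (x t) (y t) (P.output ω (x t) (y t))} := by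
    intro t
    have : {ω | Correct k (x t) (y t) (P.output ω (x t) (y t))} =
        ⋃ c : Fin b → Bool, ⋃ S : {S : Finset (Fin (2 ^ r)) // Correct k (x t) (y t) S},
          {ω | P.alice ω (x t) = c} ∩ {ω | P.bob ω c (y t) = S.1} := by
      ext ω
      simp only [Set.mem_ofPred_eq, Set.mem_iUnion, Set.mem_inter_iff]
      constructor
      · intro hc
        exact ⟨_, ⟨_, hc⟩, rfl, rfl⟩
      · rintro ⟨c, ⟨S, hS⟩, rfl, h2⟩
        rw [Protocol.output, h2]
        exact hS
    rw [this]
    exact MeasurableSet.iUnion fun c => MeasurableSet.iUnion fun S =>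
      (P.measurable_alice _ _).inter (P.measurable_bob _ _ _)
  have hint : ∀ t ∈ (univ : Finset τ), Integrable (Set.indicator
      {ω | Correct k (x t) (y t) (P.output ω (x t) (y t))} (fun _ => (1 : ℝ))) P.μ :=
    fun t _ => (integrable_const 1).indicator (hms t)
  obtain ⟨ω, hω⟩ := exists_integral_le (integrable_finsetSum _ hint)
  refine ⟨ω, le_trans ?_ hω⟩
  rw [integral_finsetSum _ hint]
  have : ∑ _t : τ, (1 - δ) = (Fintype.card τ : ℝ) * (1 - δ) := by
    simp only [sum_const, card_univ, nsmul_eq_mul]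
  rw [← this]
  refine Finset.sum_le_sum fun t _ => ?_
  rw [integral_indicator_const _ (hms t)]
  have h1 := hP _ _ (h t)
  have h2 := measureReal_compl (μ := P.μ) (hms t)
  rw [probReal_univ] at h2
  simp only [Set.compl_ofPred] at h2
  simp only [smul_eq_mul, mul_one]
  linarith

/-- With no message at all, the failure probability is at least `1 / 2`. -/
theorem Protocol.Solves.pos_of_lt {r b k m : ℕ} {δ : ℝ} {P : Protocol r b}
    (hP : P.Solves k m δ) (hk : 1 ≤ k) (hkm : 2 * k ≤ m) (hm : m ≤ 2 ^ r) (hδ : δ < 1 / 2) :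
    1 ≤ b := by
  classical
  by_contra! hb
  obtain rfl : b = 0 := by omega
  obtain ⟨s, hs⟩ : ∃ s : Finset (Fin (2 ^ r)), s.card = k :=
    (Finset.exists_subset_card_eq (s := univ) (by simp; omega)).imp fun _ h => h.2
  obtain ⟨t, hts, ht⟩ : ∃ t ⊆ sᶜ, t.card = k :=
    Finset.exists_subset_card_eq (by rw [card_compl, Fintype.card_fin]; omega)
  -- With Bob's input zero and no message, a single output would have to lie in two disjoint sets.
  let x : Bool → Input r := fun c i => decide (i ∈ bif c then s else t)
  have hx : ∀ c, supp (x c) = bif c then s else t := fun c => by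
    ext i; simp [supp, x]
  have hy : supp (fun _ => false : Input r) = ∅ := by simp [supp]
  have hpr : ∀ c, Promise r k m (x c) (fun _ => false) := fun c => by
    have : #(bif c then s else t) = k := by cases c <;> simp [hs, ht]
    rw [Promise, hx, hy, sdiff_empty, this]
    exact ⟨empty_subset _, le_rfl, by omega⟩
  obtain ⟨ω, hω⟩ := hP.exists_outcome x (fun _ _ => false) hpr
  have hmsg : P.alice ω (x true) = P.alice ω (x false) := Subsingleton.elim _ _
  have hall : ∀ c, Correct k (x c) (fun _ => false) (P.output ω (x c) fun _ => false) := by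
    have hle : ∀ c, Set.indicator {ω | Correct k (x c) (fun _ => false)
        (P.output ω (x c) fun _ => false)} (fun _ => (1 : ℝ)) ω ≤ 1 := fun c =>
      Set.indicator_apply_le' (fun _ => le_rfl) (fun _ => zero_le_one)
    rw [Fintype.sum_bool, Fintype.card_bool] at hω
    intro c
    by_contra hc
    have h0 : Set.indicator {ω | Correct k (x c) (fun _ => false)
        (P.output ω (x c) fun _ => false)} (fun _ => (1 : ℝ)) ω = 0 :=
      Set.indicator_of_notMem (s := {ω | Correct k (x c) (fun _ => false)
        (P.output ω (x c) fun _ => false)}) hc _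
    have h1 := hle true
    have h2 := hle false
    cases c <;> push_cast at hω <;> linarith
  have h1 := hall true
  have h2 := hall false
  rw [Protocol.output, hmsg] at h1
  rw [Protocol.output] at h2
  set S := P.bob ω (P.alice ω (x false)) fun _ => false
  obtain ⟨i, hi⟩ : S.Nonempty := card_pos.1 (by rw [h1.1]; omega)
  have h3 : i ∈ s := by simpa [x] using h1.2 i hi
  have h4 : i ∈ t := by simpa [x] using h2.2 i hi
  exact mem_compl.1 (hts h4) h3

/-! ### The hard instance and its encoding -/

section HardInstance

/-- The strings `e` and `ρ` agree below position `j`. -/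
def Agree {R : ℕ} (ρ : Fin R → Bool) (j : Fin R) (e : Fin R → Bool) : Prop :=
  ∀ i < j, e i = ρ i

/-- The length of the longest common prefix of `e` and `ρ`. -/
def agreement {R : ℕ} (ρ e : Fin R → Bool) : ℕ :=
  #{j : Fin R | ∀ i ≤ j, e i = ρ i}

theorem agreement_lt_of_not_agree {R : ℕ} {ρ e : Fin R → Bool} {j : Fin R}
    (h : ¬ Agree ρ j e) : agreement ρ e < j := by
  simp only [Agree, not_forall] at h
  obtain ⟨i, hij, hi⟩ := h
  refine lt_of_le_of_lt ?_ hij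
  rw [← Fin.card_Iio i]
  refine card_le_card fun l hl => ?_
  simp only [mem_filter, mem_univ, true_and, mem_Iio] at hl ⊢
  by_contra! hil
  exact hi (hl i hil)

/-- With `agreement_lt_of_not_agree`, this makes `agreement ρ` the decoding order: blocks shown at
step `j` have level below `j`, blocks found there have level exactly `j`. -/
theorem agreement_eq {R : ℕ} {ρ e : Fin R → Bool} {j : Fin R}
    (h : Agree ρ j e) (hj : e j ≠ ρ j) : agreement ρ e = j := by
  rw [← Fin.card_Iio j, agreement]
  congr 1
  ext l
  simp only [mem_filter, mem_univ, true_and, mem_Iio]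
  constructor
  · intro hl
    by_contra! hjl
    exact hj (hl j hjl)
  · intro hl i hil
    exact h i (hil.trans_lt hl)

variable {r b k R L : ℕ} (emb : (Fin k × (Fin R → Bool)) × Fin L ↪ Fin (2 ^ r))

open Classical in
/-- Alice's input: one element in each block, as chosen by `f`. -/
noncomputable def chosen (f : Fin k × (Fin R → Bool) → Fin L) : Input r :=
  fun i => decide (∃ e, emb (e, f e) = i)

open Classical in
/-- Bob's input: the elements chosen in the blocks that disagree with `ρ` below `j`. -/
noncomputable def revealed (ρ : Fin R → Bool) (j : Fin R) (f : Fin k × (Fin R → Bool) → Fin L) :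
    Input r :=
  fun i => decide (∃ e, ¬ Agree ρ j e.2 ∧ emb (e, f e) = i)

open Classical in
theorem chosen_ne_revealed_iff (ρ : Fin R → Bool) (j : Fin R)
    (f : Fin k × (Fin R → Bool) → Fin L) (e : Fin k × (Fin R → Bool)) (p : Fin L) :
    chosen emb f (emb (e, p)) ≠ revealed emb ρ j f (emb (e, p)) ↔ p = f e ∧ Agree ρ j e.2 := by
  have h1 : (∃ e', emb (e', f e') = emb (e, p)) ↔ p = f e := by
    constructor
    · rintro ⟨e', he'⟩
      obtain ⟨rfl, h⟩ := Prod.ext_iff.1 (emb.injective he')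
      exact h.symm
    · rintro rfl
      exact ⟨e, rfl⟩
  have h2 : (∃ e', ¬ Agree ρ j e'.2 ∧ emb (e', f e') = emb (e, p)) ↔
      ¬ Agree ρ j e.2 ∧ p = f e := by
    constructor
    · rintro ⟨e', h, he'⟩
      obtain ⟨rfl, h'⟩ := Prod.ext_iff.1 (emb.injective he')
      exact ⟨h, h'.symm⟩
    · rintro ⟨h, rfl⟩
      exact ⟨e, h, rfl⟩
  rw [chosen, revealed, show _ = decide (p = f e) from decide_eq_decide.2 h1,
    show _ = decide (¬ Agree ρ j e.2 ∧ p = f e) from decide_eq_decide.2 h2]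
  by_cases hp : p = f e <;> by_cases ha : Agree ρ j e.2 <;> simp [hp, ha]

theorem exists_of_chosen_ne_revealed {ρ : Fin R → Bool} {j : Fin R}
    {f : Fin k × (Fin R → Bool) → Fin L} {i : Fin (2 ^ r)}
    (h : chosen emb f i ≠ revealed emb ρ j f i) :
    ∃ e, Agree ρ j e.2 ∧ emb (e, f e) = i := by
  by_cases h1 : ∃ e, emb (e, f e) = i
  · obtain ⟨e, rfl⟩ := h1
    exact ⟨e, ((chosen_ne_revealed_iff emb ρ j f e _).1 h).2, rfl⟩
  · have h2 : ¬ ∃ e, ¬ Agree ρ j e.2 ∧ emb (e, f e) = i := fun ⟨e, h⟩ => h1 ⟨e, h.2⟩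
    simp [chosen, revealed, h1, h2] at h

theorem promise_chosen_revealed {m : ℕ} (hm : k * 2 ^ R ≤ m) (ρ : Fin R → Bool) (j : Fin R)
    (f : Fin k × (Fin R → Bool) → Fin L) :
    Promise r k m (chosen emb f) (revealed emb ρ j f) := by
  classical
  have hsub : supp (revealed emb ρ j f) ⊆ supp (chosen emb f) := by
    intro i hi
    simp only [supp, mem_filter, mem_univ, true_and, revealed, chosen, decide_eq_true_eq] at hi ⊢
    exact hi.imp fun e h => h.2
  have hmem : ∀ i, i ∈ supp (chosen emb f) \ supp (revealed emb ρ j f) ↔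
      chosen emb f i ≠ revealed emb ρ j f i := by
    intro i
    have := @hsub i
    simp only [supp, mem_sdiff, mem_filter, mem_univ, true_and] at this ⊢
    cases h1 : chosen emb f i <;> cases h2 : revealed emb ρ j f i <;> simp_all
  refine ⟨hsub, ?_, ?_⟩
  -- The `k` blocks `(u, ρ)` are never shown to Bob.
  · have : #(univ : Finset (Fin k)) ≤ _ := Finset.card_le_card_of_injOn
      (fun u : Fin k => emb ((u, ρ), f (u, ρ)))
      (t := supp (chosen emb f) \ supp (revealed emb ρ j f))
      (fun u _ => by
        rw [mem_coe, hmem, chosen_ne_revealed_iff]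
        exact ⟨rfl, fun _ _ => rfl⟩)
      (fun u _ v _ huv => congrArg (fun z => z.1.1) (emb.injective huv))
    simpa using this
  · refine le_trans ?_ hm
    have : #(supp (chosen emb f) \ supp (revealed emb ρ j f)) ≤
        #((univ : Finset (Fin k × (Fin R → Bool))).image fun e => emb (e, f e)) := by
      refine card_le_card fun i hi => ?_
      rw [hmem] at hi
      obtain ⟨e, _, he⟩ := exists_of_chosen_ne_revealed emb hi
      exact mem_image.2 ⟨e, mem_univ _, he⟩
    refine this.trans (card_image_le.trans ?_)
    simp

theorem revealed_congr {ρ : Fin R → Bool} {j : Fin R} {f g : Fin k × (Fin R → Bool) → Fin L}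
    (h : ∀ e, ¬ Agree ρ j e.2 → f e = g e) : revealed emb ρ j f = revealed emb ρ j g := by
  funext i
  simp only [revealed]
  congr 1
  exact propext (exists_congr fun e => and_congr_right fun he => by rw [h e he])

variable (a : Input r → Fin b → Bool) (B : (Fin b → Bool) → Input r → Finset (Fin (2 ^ r)))

/-- Bob's output is correct when he is given the blocks that disagree with `ρ` below `j`. -/
def Answered (ρ : Fin R → Bool) (j : Fin R) (f : Fin k × (Fin R → Bool) → Fin L) : Prop :=
  Correct k (chosen emb f) (revealed emb ρ j f) (B (a (chosen emb f)) (revealed emb ρ j f))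

open Classical in
/-- The blocks in which a correct output of Bob contains the chosen element, and which are the first
ones to be given to him in the next step. -/
noncomputable def foundAt (ρ : Fin R → Bool) (j : Fin R) (f : Fin k × (Fin R → Bool) → Fin L) :
    Finset (Fin k × (Fin R → Bool)) :=
  {e | Answered emb a B ρ j f ∧ Agree ρ j e.2 ∧ e.2 j ≠ ρ j ∧
    emb (e, f e) ∈ B (a (chosen emb f)) (revealed emb ρ j f)}

-- For a fixed message and fixed correctness flags, Bob's answers are guesses that are never wrong,
-- as the prediction lemma demands. There are `2 ^ (b + R)` such labels.
open Classical in
theorem sum_pow_card_foundAt_le (ρ : Fin R → Bool) :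
    ∑ f : Fin k × (Fin R → Bool) → Fin L, L ^ (∑ j, #(foundAt emb a B ρ j f)) ≤
      2 ^ (b + R) * L ^ (k * 2 ^ R) := by
  let label : (Fin k × (Fin R → Bool) → Fin L) → (Fin b → Bool) × (Fin R → Bool) := fun f =>
    (a (chosen emb f), fun j => decide (Answered emb a B ρ j f))
  rw [← Finset.sum_fiberwise_of_maps_to (t := univ) (g := label) fun _ _ => mem_univ _]
  have key : ∀ c : (Fin b → Bool) × (Fin R → Bool),
      ∑ f with label f = c, L ^ (∑ j, #(foundAt emb a B ρ j f)) ≤ L ^ (k * 2 ^ R) := by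
    rintro ⟨c, φ⟩
    let Q : (Fin k × (Fin R → Bool) → Fin L) → Fin k × (Fin R → Bool) → Fin L → Prop :=
      fun f e p => ∃ j, φ j = true ∧ Agree ρ j e.2 ∧ e.2 j ≠ ρ j ∧
        emb (e, p) ∈ B c (revealed emb ρ j f)
    have := sum_pow_card_predicted_le (fun e : Fin k × (Fin R → Bool) => agreement ρ e.2) Q ?_
      ({f | label f = (c, φ)}) ?_
    · simp only [Fintype.card_fin, Fintype.card_prod, Fintype.card_fun, Fintype.card_bool] at this
      refine le_trans (le_of_eq (Finset.sum_congr rfl fun f hf => ?_)) this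
      obtain ⟨hc, hφ⟩ := Prod.ext_iff.1 (mem_filter.1 hf).2
      congr 1
      rw [← Finset.card_biUnion]
      · congr 1
        ext e
        simp only [label] at hc hφ
        simp only [mem_biUnion, mem_univ, true_and, foundAt, mem_filter, Q, ← hc, ← hφ,
          decide_eq_true_eq]
      -- A block found at step `j` has level `j`, so no block is counted at two steps.
      · intro j _ j' _ hjj'
        rw [Function.onFun, Finset.disjoint_left]
        intro e he he'
        simp only [foundAt, mem_filter, mem_univ, true_and] at he he'
        exact hjj' (Fin.ext ((agreement_eq he.2.1 he.2.2.1).symm.trans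
          (agreement_eq he'.2.1 he'.2.2.1)))
    · intro f g e h
      funext p
      refine propext (exists_congr fun j => and_congr_right fun _ => and_congr_right fun h1 =>
        and_congr_right fun h2 => ?_)
      rw [revealed_congr emb fun e' he' => h e' ?_]
      rw [agreement_eq h1 h2]
      exact agreement_lt_of_not_agree he'
    · rintro f hf e p ⟨j, hj, h1, h2, h3⟩
      obtain ⟨hc, hφ⟩ := Prod.ext_iff.1 (mem_filter.1 hf).2
      simp only [label] at hc hφ
      rw [← hφ, decide_eq_true_eq] at hj
      rw [← hc] at h3
      exact ((chosen_ne_revealed_iff emb ρ j f e p).1 (hj.2 _ h3)).1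
  refine (Finset.sum_le_card_nsmul _ _ _ fun c _ => key c).trans (le_of_eq ?_)
  simp [pow_add]

theorem sum_card_foundAt_mul_log_le (hL : 0 < L) (ρ : Fin R → Bool) :
    (∑ f : Fin k × (Fin R → Bool) → Fin L, ∑ j, (#(foundAt emb a B ρ j f) : ℝ)) * Real.log L ≤
      Fintype.card (Fin k × (Fin R → Bool) → Fin L) * ((b + R) * Real.log 2) := by
  rw [Finset.sum_mul]
  refine sum_le_card_mul_of_sum_exp_le univ _ _ ?_
  have h := sum_pow_card_foundAt_le emb a B ρ
  have h' : (∑ f : Fin k × (Fin R → Bool) → Fin L, (L : ℝ) ^ (∑ j, #(foundAt emb a B ρ j f))) ≤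
      2 ^ (b + R) * L ^ (k * 2 ^ R) := by exact_mod_cast h
  convert h' using 1
  · refine Finset.sum_congr rfl fun f _ => ?_
    rw [← Nat.cast_sum, Real.exp_nat_mul, Real.exp_log (by exact_mod_cast hL)]
  · have : ((b : ℝ) + R) = ((b + R : ℕ) : ℝ) := by push_cast; rfl
    rw [this, Real.exp_nat_mul, Real.exp_log two_pos]
    simp

-- Flipping bit `j` of `ρ` changes neither Bob's input nor his output, and each of the `k` elements
-- of a correct output is found for exactly one of the two strings.
open Classical in
theorem two_mul_sum_card_foundAt (j : Fin R) (f : Fin k × (Fin R → Bool) → Fin L) :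
    2 * ∑ ρ, #(foundAt emb a B ρ j f) = k * #{ρ | Answered emb a B ρ j f} := by
  let flip : (Fin R → Bool) → (Fin R → Bool) := fun ρ => Function.update ρ j (!ρ j)
  have hflip : Function.Involutive flip := fun ρ => by
    funext i
    by_cases h : i = j
    · subst h; simp [flip]
    · simp [flip, h]
  have hA : ∀ ρ e, Agree (flip ρ) j e ↔ Agree ρ j e := fun ρ e =>
    forall₂_congr fun i hi => by simp [flip, hi.ne]
  have hrev : ∀ ρ, revealed emb (flip ρ) j f = revealed emb ρ j f := fun ρ => by
    funext i; simp only [revealed, hA]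
  have hAns : ∀ ρ, Answered emb a B (flip ρ) j f ↔ Answered emb a B ρ j f := fun ρ => by
    simp only [Answered, hrev]
  have hpair : ∀ ρ, #(foundAt emb a B ρ j f) + #(foundAt emb a B (flip ρ) j f) =
      if Answered emb a B ρ j f then k else 0 := by
    intro ρ
    split_ifs with h
    · rw [← card_union_of_disjoint]
      · refine Eq.trans ?_ h.1
        refine card_bij (fun e _ => emb (e, f e)) ?_ ?_ ?_
        · intro e he
          rw [mem_union] at he
          simp only [foundAt, mem_filter, mem_univ, true_and, hrev] at he
          exact he.elim (fun h => h.2.2.2) (fun h => h.2.2.2)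
        · intro e _ e' _ hee
          exact congrArg Prod.fst (emb.injective hee)
        · intro i hi
          obtain ⟨e, he, rfl⟩ := exists_of_chosen_ne_revealed emb (h.2 i hi)
          refine ⟨e, ?_, rfl⟩
          simp only [foundAt, mem_union, mem_filter, mem_univ, true_and, hrev, hA, hAns, h, he, hi,
            and_true]
          simp only [flip, Function.update_self]
          cases e.2 j <;> cases ρ j <;> simp
      · rw [Finset.disjoint_left]
        intro e he he'
        simp only [foundAt, mem_filter, mem_univ, true_and, flip, Function.update_self] at he he'
        have h1 := he.2.2.1
        have h2 := he'.2.2.1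
        revert h1 h2
        cases e.2 j <;> cases ρ j <;> simp
    · simp [foundAt, h, hAns]
  have hsum : ∑ ρ, #(foundAt emb a B (flip ρ) j f) = ∑ ρ, #(foundAt emb a B ρ j f) :=
    Equiv.sum_comp hflip.toPerm fun ρ => #(foundAt emb a B ρ j f)
  rw [two_mul]
  nth_rewrite 2 [← hsum]
  rw [← Finset.sum_add_distrib, Finset.sum_congr rfl fun ρ _ => hpair ρ, ← Finset.sum_filter,
    Finset.sum_const, smul_eq_mul, mul_comm]

end HardInstance

/-! ### Averaging over the hard instance and choice of parameters -/

/-- The lower bound in terms of the parameters `R` (the number of steps) and `L` (the size of the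
blocks) of the hard instance. -/
theorem Protocol.Solves.mul_log_le {r b k m : ℕ} {δ : ℝ} {P : Protocol r b}
    (hP : P.Solves k m δ) {R L : ℕ} (hL : 0 < L) (hm : k * 2 ^ R ≤ m)
    (hr : k * 2 ^ R * L ≤ 2 ^ r) :
    k / 2 * (1 - δ) * R * Real.log L ≤ (b + R) * Real.log 2 := by
  classical
  obtain ⟨emb⟩ : Nonempty ((Fin k × (Fin R → Bool)) × Fin L ↪ Fin (2 ^ r)) :=
    Function.Embedding.nonempty_of_card_le (by simpa using hr)
  have : NeZero L := ⟨hL.ne'⟩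
  -- One outcome is fixed for the average over all `(f, j, ρ)`; the encoding then uses a
  -- deterministic protocol.
  obtain ⟨ω, hω⟩ := hP.exists_outcome
    (τ := (Fin k × (Fin R → Bool) → Fin L) × Fin R × (Fin R → Bool))
    (fun t => chosen emb t.1) (fun t => revealed emb t.2.2 t.2.1 t.1)
    (fun t => promise_chosen_revealed emb hm t.2.2 t.2.1 t.1)
  set a := P.alice ω
  set B := P.bob ω
  set N := Fintype.card (Fin k × (Fin R → Bool) → Fin L) with hN
  have hNpos : (0 : ℝ) < N := by exact_mod_cast Fintype.card_pos
  have h1 : (N : ℝ) * (R * 2 ^ R) * (1 - δ) ≤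
      ∑ f : Fin k × (Fin R → Bool) → Fin L, ∑ j : Fin R,
        (#{ρ | Answered emb a B ρ j f} : ℝ) := by
    refine le_trans (le_of_eq ?_) (hω.trans (le_of_eq ?_))
    · rw [Fintype.card_prod, Fintype.card_prod]
      simp [hN]
    · rw [Fintype.sum_prod_type]
      refine Finset.sum_congr rfl fun f _ => ?_
      rw [Fintype.sum_prod_type]
      refine Finset.sum_congr rfl fun j _ => ?_
      rw [Finset.card_filter]
      push_cast
      refine Finset.sum_congr rfl fun ρ _ => ?_
      simp only [Set.indicator_apply]
      rfl
  have h2 := Finset.sum_le_sum fun (ρ : Fin R → Bool) (_ : ρ ∈ univ) =>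
    sum_card_foundAt_mul_log_le emb a B hL ρ
  rw [← Finset.sum_mul, Finset.sum_comm] at h2
  have h3 : ∑ f : Fin k × (Fin R → Bool) → Fin L, ∑ ρ, ∑ j, (#(foundAt emb a B ρ j f) : ℝ) =
      k / 2 * ∑ f : Fin k × (Fin R → Bool) → Fin L, ∑ j : Fin R,
        (#{ρ | Answered emb a B ρ j f} : ℝ) := by
    rw [Finset.mul_sum]
    refine Finset.sum_congr rfl fun f _ => ?_
    rw [Finset.sum_comm, Finset.mul_sum]
    refine Finset.sum_congr rfl fun j _ => ?_
    have := two_mul_sum_card_foundAt emb a B j f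
    have : (2 : ℝ) * ∑ ρ, (#(foundAt emb a B ρ j f) : ℝ) =
      k * (#{ρ | Answered emb a B ρ j f} : ℝ) := by exact_mod_cast this
    linarith
  rw [h3] at h2
  simp only [Finset.sum_const, nsmul_eq_mul, card_univ, Fintype.card_fun, Fintype.card_bool,
    Fintype.card_fin] at h2
  have hlog : 0 ≤ Real.log L := Real.log_natCast_nonneg L
  have h4 : (k : ℝ) / 2 * (N * (R * 2 ^ R) * (1 - δ)) * Real.log L ≤
      2 ^ R * (N * ((b + R) * Real.log 2)) := by
    refine le_trans ?_ (le_trans h2 (le_of_eq ?_))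
    · gcongr
    · push_cast [hN]
      simp
  have h5 : (0 : ℝ) < 2 ^ R * N := by positivity
  refine le_of_mul_le_mul_left ?_ h5
  linarith

end UniversalRelation

theorem mainTheorem6 (ε : ℝ) (hε : 0 < ε) :
    ∃ c : ℝ, 0 < c ∧
      ∀ (r k m : ℕ) (δ : ℝ),
        2 ≤ r → 1 ≤ k →
        max (2 * (k : ℝ)) (Real.log r ^ 5) ≤ m → m ≤ 2 ^ r →
        (k : ℝ) ≤ (2 : ℝ) ^ ((1 - ε) * (r : ℝ)) →
        0 ≤ δ → δ ≤ 1 / (r : ℝ) ^ 5 →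
        c * ((k : ℝ) * r * Real.log ((m : ℝ) / k)) ≤
          (UniversalRelation.complexity r k m δ : ℝ) := by
  set A : ℝ := 32 / ε with hA
  have hA0 : 0 < A := by positivity
  refine ⟨min (ε / 32) (1 / ((2 : ℝ) ^ A * A * A)), by positivity, ?_⟩
  intro r k m δ hr hk hm hmr hkr _ hδ
  obtain ⟨P, hP⟩ := Nat.sInf_mem (UniversalRelation.exists_protocol r k m ‹0 ≤ δ›)
  change P.Solves k m δ at hP
  set b := UniversalRelation.complexity r k m δ with hb
  change UniversalRelation.Protocol r b at P
  have hkm' : 2 * (k : ℝ) ≤ m := (le_max_left _ _).trans hm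
  have hkm : 2 * k ≤ m := by exact_mod_cast hkm'
  have hk1 : (1 : ℝ) ≤ k := by exact_mod_cast hk
  have hr2 : (2 : ℝ) ≤ r := by exact_mod_cast hr
  have hmr' : (m : ℝ) ≤ 2 ^ r := by exact_mod_cast hmr
  have hm0 : (0 : ℝ) < m := by linarith
  have hδ' : δ ≤ 1 / 32 := by
    refine hδ.trans (one_div_le_one_div_of_le (by norm_num) ?_)
    calc (32 : ℝ) = 2 ^ 5 := by norm_num
      _ ≤ (r : ℝ) ^ 5 := by gcongr
  have hmk : 2 ≤ (m : ℝ) / k := by rw [le_div_iff₀ (by linarith)]; exact hkm'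
  have hlog0 : 0 ≤ Real.log ((m : ℝ) / k) := Real.log_nonneg (by linarith)
  have hlog2 : 0 < Real.log 2 := Real.log_pos one_lt_two
  have hlog2' : Real.log 2 < 1 := by linarith [Real.log_two_lt_d9]
  rcases le_or_gt (r : ℝ) A with hrA | hrA
  -- For `r ≤ A`, all of `k ≤ 2 ^ A`, `r ≤ A` and `log (m / k) ≤ A` hold, so the second constant
  -- makes the left side at most `1`.
  · have hb1 : 1 ≤ b := hP.pos_of_lt hk hkm hmr (by linarith)
    have hpow : (2 : ℝ) ^ r ≤ (2 : ℝ) ^ A := by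
      rw [← Real.rpow_natCast]; exact Real.rpow_le_rpow_of_exponent_le one_le_two hrA
    have h1 : (k : ℝ) ≤ (2 : ℝ) ^ A := by linarith
    have h2 : Real.log ((m : ℝ) / k) ≤ A := by
      calc Real.log ((m : ℝ) / k) ≤ Real.log ((2 : ℝ) ^ r) := by
            refine Real.log_le_log (by linarith) ((div_le_self hm0.le hk1).trans hmr')
        _ = r * Real.log 2 := Real.log_pow _ _
        _ ≤ r * 1 := by gcongr
        _ ≤ A := by linarith
    calc min (ε / 32) (1 / ((2 : ℝ) ^ A * A * A)) * ((k : ℝ) * r * Real.log ((m : ℝ) / k))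
        ≤ 1 / ((2 : ℝ) ^ A * A * A) * ((2 : ℝ) ^ A * A * A) := by
          gcongr
          exact min_le_right _ _
      _ = 1 := by field_simp
      _ ≤ b := by exact_mod_cast hb1
  · have hεr : 32 < ε * r := by
      rw [hA, div_lt_iff₀ hε] at hrA; linarith
    set x := Real.logb 2 ((m : ℝ) / k) with hx
    have hx1 : 1 ≤ x := by
      rw [hx, Real.le_logb_iff_rpow_le one_lt_two (by linarith)]; simpa using hmk
    have hxlog : Real.log ((m : ℝ) / k) ≤ x := by
      rw [hx, Real.logb, le_div_iff₀ hlog2]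
      exact mul_le_of_le_one_right hlog0 hlog2'.le
    set R := ⌈x / 2⌉₊ with hR
    have hRge : x / 2 ≤ R := Nat.le_ceil _
    have hRlt : (R : ℝ) < x / 2 + 1 := Nat.ceil_lt_add_one (by linarith)
    have hRx : (R : ℝ) ≤ x := by
      rcases le_or_gt 2 x with h | h
      · linarith
      · have : R ≤ 1 := Nat.ceil_le.2 (by push_cast; linarith)
        have : (R : ℝ) ≤ 1 := by exact_mod_cast this
        linarith
    have hRm : k * 2 ^ R ≤ m := by
      have : (k : ℝ) * 2 ^ R ≤ m := by
        calc (k : ℝ) * 2 ^ R = k * (2 : ℝ) ^ (R : ℝ) := by rw [Real.rpow_natCast]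
          _ ≤ k * (2 : ℝ) ^ x := by
            gcongr
            exact one_le_two
          _ = m := by
            rw [hx, Real.rpow_logb two_pos (by norm_num) (by linarith)]
            field_simp
      exact_mod_cast this
    set L := 2 ^ r / (k * 2 ^ R) with hL
    have hkR : 0 < k * 2 ^ R := by positivity
    have hL0 : 0 < L := Nat.div_pos (hRm.trans hmr) hkR
    -- The exponent is at most `(log₂ m + log₂ k) / 2 + 1`, with `log₂ m ≤ r` and `log₂ k ≤ (1 - ε)
    -- r`.
    have hkR2 : (k : ℝ) * 2 ^ R ≤ (2 : ℝ) ^ ((1 - ε / 2) * r + 1) := by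
      have hκ : Real.logb 2 k ≤ (1 - ε) * r := by
        rwa [Real.logb_le_iff_le_rpow one_lt_two (by linarith)]
      have hμ : Real.logb 2 m ≤ r := by
        rw [Real.logb_le_iff_le_rpow one_lt_two hm0, Real.rpow_natCast]; exact hmr'
      have hxe : x = Real.logb 2 m - Real.logb 2 k :=
        Real.logb_div hm0.ne' (by linarith)
      calc (k : ℝ) * 2 ^ R = (2 : ℝ) ^ (Real.logb 2 k) * (2 : ℝ) ^ (R : ℝ) := by
            rw [Real.rpow_natCast, Real.rpow_logb two_pos (by norm_num) (by linarith)]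
        _ = (2 : ℝ) ^ (Real.logb 2 k + R) := (Real.rpow_add two_pos _ _).symm
        _ ≤ _ := Real.rpow_le_rpow_of_exponent_le one_le_two (by nlinarith)
    have hLge : (2 : ℝ) ^ (ε * r / 2 - 2) ≤ L := by
      have h1 : (2 : ℝ) ^ r < k * 2 ^ R * (L + 1) := by
        exact_mod_cast Nat.lt_mul_div_succ (2 ^ r) hkR
      have h2 : (1 : ℝ) ≤ L := by exact_mod_cast hL0
      have h3 : (2 : ℝ) ^ ((1 - ε / 2) * r + 1) * (2 : ℝ) ^ (ε * r / 2 - 2) * 2 = 2 ^ r := by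
        rw [← Real.rpow_add two_pos, ← Real.rpow_add_one two_ne_zero, ← Real.rpow_natCast]
        congr 1
        ring
      have h4 : (2 : ℝ) ^ r < (2 : ℝ) ^ ((1 - ε / 2) * r + 1) * (L * 2) := by
        refine h1.trans_le ?_
        gcongr
        linarith
      rw [← h3, mul_assoc] at h4
      have := lt_of_mul_lt_mul_left h4 (by positivity)
      linarith
    have hlogL : ε * r / 4 * Real.log 2 ≤ Real.log L := by
      calc ε * r / 4 * Real.log 2 ≤ (ε * r / 2 - 2) * Real.log 2 := by
            gcongr; linarith
        _ = Real.log ((2 : ℝ) ^ (ε * r / 2 - 2)) := (Real.log_rpow two_pos _).symm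
        _ ≤ Real.log L := Real.log_le_log (by positivity) hLge
    have hmain : k / 2 * (1 - δ) * R * Real.log L ≤ (b + R) * Real.log 2 :=
      hP.mul_log_le hL0 hRm (Nat.mul_div_le _ _)
    have h1 : (k : ℝ) / 2 * (31 / 32) * R * (ε * r / 4) ≤ b + R := by
      refine le_of_mul_le_mul_right ?_ hlog2
      refine le_trans ?_ hmain
      have : (k : ℝ) / 2 * (31 / 32) * R ≤ k / 2 * (1 - δ) * R := by
        gcongr
        linarith
      calc (k : ℝ) / 2 * (31 / 32) * R * (ε * r / 4) * Real.log 2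
          = k / 2 * (31 / 32) * R * (ε * r / 4 * Real.log 2) := by ring
        _ ≤ k / 2 * (31 / 32) * R * Real.log L := by gcongr
        _ ≤ _ := mul_le_mul_of_nonneg_right this (Real.log_natCast_nonneg L)
    have hz : 32 ≤ k * (ε * r) := by nlinarith
    -- By `hz`, the cost `R` of the flags is at most `R k ε r / 32`, and `31/256 - 1/32 ≥ 1/16`.
    have h2 : (R : ℝ) * (k * (ε * r) / 16) ≤ b := by
      have := mul_le_mul_of_nonneg_left hz (Nat.cast_nonneg (α := ℝ) R)
      nlinarith
    calc min (ε / 32) (1 / ((2 : ℝ) ^ A * A * A)) * ((k : ℝ) * r * Real.log ((m : ℝ) / k))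
        ≤ ε / 32 * ((k : ℝ) * r * x) := by
          gcongr
          exact min_le_left _ _
      _ = x / 2 * (k * (ε * r) / 16) := by ring
      _ ≤ R * (k * (ε * r) / 16) := by gcongr
      _ ≤ b := h2
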